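/- **Theorem 1.** Let $d\ge 1$. For a normalized pure state $|\psi\rangle\in\mathbb C^d\otimes\mathbb C^d$ with Schmidt numbers $\lambda_0,\dots,\lambda_{d-1}$ (the eigenvalues, with multiplicity, of the reduced density matrix of $|\psi\rangle\langle\psi|$ on one subsystem), the $G$-concurrence is $G_d(|\psi\rangle)=d\,(\lambda_0\lambda_1\cdots\lambda_{d-1})^{1/d}$. For a density matrix $\rho$ on $\mathbb C^d\otimes\mathbb C^d$ it is given by the convex roof $$G_d(\rho)=\min\Big\{\sum_i p_i\,G_d(|\psi_i\rangle)\;:\;\rho=\sum_i p_i|\psi_i\rangle\langle\psi_i|\Big\},$$ over all finite decompositions of $\rho$ into normalized pure states with probabilities $p_i$. Let $\rho_{12}$ and $\rho_{34}$ be density matrices on $\mathbb C^d\otimes\mathbb C^d$, and let Alice (holding share 1), Bob (holding share 4) and Sapna (holding shares 2 and 3) start from the state $\rho_{12}\otimes\rho_{34}$. Let them apply any LOCC protocol, that is, a finite sequence of steps in each of which one party performs on the systems it holds a measurement with finitely many Kraus operators $K_j$, $\sum_jK_j^\dagger K_j=I$ (local ancillas may be added and local systems discarded), and announces the outcome; the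 choice of each step may depend on all earlier outcomes. At the end Alice and Bob each hold a $d$-dimensional system, Sapna's system is traced out, and outcomes may be grouped together (classical information may be forgotten). Let $\{Q_j,\sigma_{14}^j\}_{j=1}^{r}$ be the resulting ensemble shared by Alice and Bob: with probability $Q_j$ they share the state $\sigma_{14}^j$. Then $$\sum_{j=1}^{r}Q_j\,G_d(\sigma_{14}^j)\;\le\;G_d(\rho_{12})\,G_d(\rho_{34}).$$ -/

import Mathlib

open scoped ComplexOrder Kronecker Matrix

noncomputable section

namespace QNet

/-- `ρ` is a density matrix: positive semidefinite of trace one. -/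
def IsDensity {n : Type*} [Fintype n] (ρ : Matrix n n ℂ) : Prop :=
  ρ.PosSemidef ∧ ρ.trace = 1

/-- `ψ` is a normalized pure state of a `d × d` bipartite system;
`ψ (i, j)` is its coefficient at `|i⟩|j⟩`. -/
def IsPureState {d : ℕ} (ψ : Fin d × Fin d → ℂ) : Prop :=
  ∑ x, ‖ψ x‖ ^ 2 = 1

/-- The coefficient matrix `(a_ij)` of `|ψ⟩ = ∑ a_ij |i⟩|j⟩`. -/
def coeffMatrix {d : ℕ} (ψ : Fin d × Fin d → ℂ) : Matrix (Fin d) (Fin d) ℂ :=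
  Matrix.of fun i j => ψ (i, j)

/-- The reduced density matrix of `|ψ⟩⟨ψ|` on the first subsystem. -/
def reducedState {d : ℕ} (ψ : Fin d × Fin d → ℂ) : Matrix (Fin d) (Fin d) ℂ :=
  coeffMatrix ψ * (coeffMatrix ψ)ᴴ

theorem reducedState_isHermitian {d : ℕ} (ψ : Fin d × Fin d → ℂ) :
    (reducedState ψ).IsHermitian :=
  Matrix.isHermitian_mul_conjTranspose_self (coeffMatrix ψ)

/-- The Schmidt numbers `λ_0, …, λ_{d-1}` of `|ψ⟩` (the squares of its Schmidt coefficients):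
the eigenvalues of the reduced state, with multiplicity. -/
def schmidtNumbers {d : ℕ} (ψ : Fin d × Fin d → ℂ) : Fin d → ℝ :=
  (reducedState_isHermitian ψ).eigenvalues

/-- The `G`-concurrence of a pure state, `d (λ_0 λ_1 ⋯ λ_{d-1})^{1/d}`. -/
def pureGConcurrence {d : ℕ} (ψ : Fin d × Fin d → ℂ) : ℝ :=
  d * (∏ k, schmidtNumbers ψ k) ^ (1 / (d : ℝ))

/-- The finite family `(p i, ψ i)` is a decomposition of `ρ` into pure states:
`ρ = ∑ p_i |ψ_i⟩⟨ψ_i|` with probabilities `p_i` and normalized `ψ_i`. -/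
def IsDecomposition {d n : ℕ} (ρ : Matrix (Fin d × Fin d) (Fin d × Fin d) ℂ)
    (p : Fin n → ℝ) (ψ : Fin n → Fin d × Fin d → ℂ) : Prop :=
  (∀ i, 0 ≤ p i) ∧ ∑ i, p i = 1 ∧ (∀ i, IsPureState (ψ i)) ∧
    ρ = ∑ i, (p i : ℂ) • Matrix.vecMulVec (ψ i) (star (ψ i))

/-- The `G`-concurrence of a mixed state: the convex roof of `pureGConcurrence`, i.e. the least
average over all finite decompositions into pure states. (For a density matrix the set below is
nonempty and bounded below by `0`.) -/
def gConcurrence {d : ℕ} (ρ : Matrix (Fin d × Fin d) (Fin d × Fin d) ℂ) : ℝ :=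
  sInf {g : ℝ | ∃ (n : ℕ) (p : Fin n → ℝ) (ψ : Fin n → Fin d × Fin d → ℂ),
    IsDecomposition ρ p ψ ∧ g = ∑ i, p i * pureGConcurrence (ψ i)}

/-- Finite LOCC protocols of Alice, Sapna and Bob, as trees. In `LOCC d r a s b` the current local
dimensions of Alice, Sapna and Bob are `a`, `s`, `b`. In each step one party measures its own
system, with Kraus operators `K j` satisfying the completeness relation, and announces the outcome
`j`, on which the whole continuation may depend. An operator `K j` may change the local dimension,
so that local ancillas may be added, and partly measured or discarded. The protocol
ends with `d`-dimensional systems at Alice and Bob and returns one of `r` labels;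
different branches may return the same label, so that classical information may be forgotten. -/
inductive LOCC (d r : ℕ) : ℕ → ℕ → ℕ → Type
  | halt {s : ℕ} (label : Fin r) : LOCC d r d s d
  | alice {a s b n : ℕ} {m : Fin n → ℕ} (K : (j : Fin n) → Matrix (Fin (m j)) (Fin a) ℂ)
      (complete : ∑ j, (K j)ᴴ * K j = 1) (next : (j : Fin n) → LOCC d r (m j) s b) :
      LOCC d r a s b
  | sapna {a s b n : ℕ} {m : Fin n → ℕ} (K : (j : Fin n) → Matrix (Fin (m j)) (Fin s) ℂ)
      (complete : ∑ j, (K j)ᴴ * K j = 1) (next : (j : Fin n) → LOCC d r a (m j) b) :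
      LOCC d r a s b
  | bob {a s b n : ℕ} {m : Fin n → ℕ} (K : (j : Fin n) → Matrix (Fin (m j)) (Fin b) ℂ)
      (complete : ∑ j, (K j)ᴴ * K j = 1) (next : (j : Fin n) → LOCC d r a s (m j)) :
      LOCC d r a s b

/-- Operators on the joint system of Alice, Sapna and Bob, in this order. -/
abbrev Joint (a s b : ℕ) : Type := Matrix (Fin a × Fin s × Fin b) (Fin a × Fin s × Fin b) ℂ

/-- `K ρ K†`, the unnormalized state after the outcome with Kraus operator `K`. -/
def conjugate {m n : Type*} [Fintype n] (K : Matrix m n ℂ) (ρ : Matrix n n ℂ) : Matrix m m ℂ :=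
  K * ρ * Kᴴ

/-- The partial trace over Sapna's system. -/
def traceSapna {a s b : ℕ} (ρ : Joint a s b) : Matrix (Fin a × Fin b) (Fin a × Fin b) ℂ :=
  Matrix.of fun x y => ∑ k, ρ (x.1, k, x.2) (y.1, k, y.2)

/-- The unnormalized state `Q_j σ_j` that Alice and Bob share when the protocol, started in the
joint state `ρ`, returns the label `j`: the sum over all branches that end in `j`. -/
def LOCC.run {d r : ℕ} : {a s b : ℕ} → LOCC d r a s b → Joint a s b → Fin r →
    Matrix (Fin d × Fin d) (Fin d × Fin d) ℂ
  | _, _, _, .halt label, ρ, j => if label = j then traceSapna ρ else 0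
  | _, s, b, .alice K _ next, ρ, j =>
      ∑ i, (next i).run (conjugate
        (K i ⊗ₖ ((1 : Matrix (Fin s) (Fin s) ℂ) ⊗ₖ (1 : Matrix (Fin b) (Fin b) ℂ))) ρ) j
  | a, _, b, .sapna K _ next, ρ, j =>
      ∑ i, (next i).run (conjugate
        ((1 : Matrix (Fin a) (Fin a) ℂ) ⊗ₖ (K i ⊗ₖ (1 : Matrix (Fin b) (Fin b) ℂ))) ρ) j
  | a, s, _, .bob K _ next, ρ, j =>
      ∑ i, (next i).run (conjugate
        ((1 : Matrix (Fin a) (Fin a) ℂ) ⊗ₖ ((1 : Matrix (Fin s) (Fin s) ℂ) ⊗ₖ K i)) ρ) j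

/-- The probability `Q_j` of the label `j`. -/
def LOCC.prob {d r a s b : ℕ} (P : LOCC d r a s b) (ρ : Joint a s b) (j : Fin r) : ℝ :=
  (P.run ρ j).trace.re

/-- The state `σ_j` shared by Alice and Bob, given the label `j` (meaningful if `Q_j ≠ 0`). -/
def LOCC.finalState {d r a s b : ℕ} (P : LOCC d r a s b) (ρ : Joint a s b) (j : Fin r) :
    Matrix (Fin d × Fin d) (Fin d × Fin d) ℂ :=
  ((P.prob ρ j : ℂ)⁻¹) • P.run ρ j

/-- The state `ρ₁₂ ⊗ ρ₃₄` with Alice holding share 1, Bob holding share 4, and Sapna holding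
shares 2 and 3 (her index `k : Fin (d * d)` encodes a pair of indices of shares 2 and 3). -/
def initialState {d : ℕ} (ρ₁₂ ρ₃₄ : Matrix (Fin d × Fin d) (Fin d × Fin d) ℂ) :
    Joint d (d * d) d :=
  (ρ₁₂ ⊗ₖ ρ₃₄).submatrix
    (fun x => ((x.1, (finProdFinEquiv.symm x.2.1).1), ((finProdFinEquiv.symm x.2.1).2, x.2.2)))
    (fun x => ((x.1, (finProdFinEquiv.symm x.2.1).1), ((finProdFinEquiv.symm x.2.1).2, x.2.2)))

end QNet

end

/-!
The pure-state `G`-concurrence `d |det A|^{2/d}` of a vector with coefficient matrix `A` is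
quadratic in the vector, multiplicative in `A` up to the factor `d`, and, by the
arithmetic-geometric mean inequality, at most the squared Hilbert–Schmidt norm of `A`
(`pureGConcurrence_le`).

Start from pure states with coefficient matrices `A` and `B`. Along a branch of the protocol, Alice,
Sapna and Bob accumulate local operators `M`, `S`, `N`, and tracing out Sapna leaves the ensemble of
unnormalized vectors with coefficient matrices `M A C_k B Nᵀ`, where `C_k` is the `k`-th row of `S`
read as a `d × d` matrix. Factoring the determinant and estimating only the factors `M`, `C_k`, `N`
by their Hilbert–Schmidt norms bounds the total `G`-concurrence of the branch by
`‖M‖² ‖S‖² ‖N‖² / d⁴` times the product of the two initial concurrences. By the completeness relations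
the sum of `‖M‖² ‖S‖² ‖N‖²` over the outcomes of a measurement is the value before it, so over all
branches it is the value at the root, `d · d² · d = d⁴`; this is the induction in
`LOCC.exists_hasEnsemble_run`. Intermediate dimensions play no role, because determinants are taken
only at the leaves.

Mixed initial states follow because a protocol acts linearly
(`LOCC.sum_prob_mul_gConcurrence_le`), and then one takes the infimum over the decompositions of
both initial states (`le_gConcurrence_mul`).
-/

namespace QNet

/-! ### Hilbert–Schmidt norms -/

/-- The squared Hilbert–Schmidt norm of a matrix. -/
noncomputable def hsNormSq {m n : Type*} [Fintype m] [Fintype n] (M : Matrix m n ℂ) : ℝ :=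
  ∑ i, ∑ j, ‖M i j‖ ^ 2

theorem hsNormSq_nonneg {m n : Type*} [Fintype m] [Fintype n] (M : Matrix m n ℂ) :
    0 ≤ hsNormSq M :=
  Finset.sum_nonneg fun _ _ => Finset.sum_nonneg fun _ _ => by positivity

theorem trace_mul_conjTranspose_self {m n : Type*} [Fintype m] [Fintype n] (M : Matrix m n ℂ) :
    (M * Mᴴ).trace = (hsNormSq M : ℂ) := by
  simp [hsNormSq, Matrix.trace, Matrix.mul_apply, Complex.mul_conj']

theorem hsNormSq_one {n : Type*} [Fintype n] [DecidableEq n] :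
    hsNormSq (1 : Matrix n n ℂ) = Fintype.card n := by
  have h := trace_mul_conjTranspose_self (1 : Matrix n n ℂ)
  simp only [Matrix.conjTranspose_one, mul_one, Matrix.trace_one] at h
  exact_mod_cast h.symm

/-- A complete family of Kraus operators preserves the squared Hilbert–Schmidt norm on average. -/
theorem sum_hsNormSq_mul {ι l n : Type*} {m : ι → Type*} [Fintype ι] [Fintype l] [Fintype n]
    [DecidableEq n] [∀ i, Fintype (m i)] (K : (i : ι) → Matrix (m i) n ℂ)
    (hK : ∑ i, (K i)ᴴ * K i = 1) (M : Matrix n l ℂ) :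
    ∑ i, hsNormSq (K i * M) = hsNormSq M := by
  have h : (∑ i, (hsNormSq (K i * M) : ℂ)) = hsNormSq M := by
    calc (∑ i, (hsNormSq (K i * M) : ℂ))
        = ∑ i, ((K i)ᴴ * K i * (M * Mᴴ)).trace := by
          refine Finset.sum_congr rfl fun i _ => ?_
          rw [← trace_mul_conjTranspose_self, Matrix.trace_mul_comm, Matrix.conjTranspose_mul,
            Matrix.mul_assoc, Matrix.trace_mul_comm]
          simp only [Matrix.mul_assoc]
      _ = hsNormSq M := by
          rw [← Matrix.trace_sum, ← Finset.sum_mul, hK, one_mul, trace_mul_conjTranspose_self]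
  exact_mod_cast h

/-! ### The concurrence of pure states -/

theorem pureGConcurrence_eq {d : ℕ} (ψ : Fin d × Fin d → ℂ) :
    pureGConcurrence ψ = d * (‖(coeffMatrix ψ).det‖ ^ 2) ^ (1 / (d : ℝ)) := by
  have h := (reducedState_isHermitian ψ).det_eq_prod_eigenvalues
  have h' : (∏ k, schmidtNumbers ψ k) = ‖(coeffMatrix ψ).det‖ ^ 2 := by
    have hdet : (reducedState ψ).det = (‖(coeffMatrix ψ).det‖ : ℂ) ^ 2 := by
      rw [reducedState, Matrix.det_mul, Matrix.det_conjTranspose, Complex.star_def,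
        Complex.mul_conj']
    unfold schmidtNumbers
    refine Complex.ofReal_injective ?_
    push_cast
    exact h.symm.trans hdet
  rw [pureGConcurrence, h']

theorem pureGConcurrence_nonneg {d : ℕ} (ψ : Fin d × Fin d → ℂ) : 0 ≤ pureGConcurrence ψ := by
  rw [pureGConcurrence_eq]; positivity

/-- The arithmetic-geometric mean inequality for the Schmidt numbers. -/
theorem pureGConcurrence_le {d : ℕ} (ψ : Fin d × Fin d → ℂ) :
    pureGConcurrence ψ ≤ hsNormSq (coeffMatrix ψ) := by
  rcases Nat.eq_zero_or_pos d with rfl | hd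
  · simp [pureGConcurrence, hsNormSq]
  have hd' : (0 : ℝ) < d := by exact_mod_cast hd
  have hpos : ∀ k, 0 ≤ schmidtNumbers ψ k :=
    (Matrix.posSemidef_self_mul_conjTranspose (coeffMatrix ψ)).eigenvalues_nonneg
  have hsum : ∑ k, schmidtNumbers ψ k = hsNormSq (coeffMatrix ψ) := by
    have h := (reducedState_isHermitian ψ).trace_eq_sum_eigenvalues
    unfold schmidtNumbers
    refine Complex.ofReal_injective ?_
    push_cast
    exact h.symm.trans (trace_mul_conjTranspose_self (coeffMatrix ψ))
  have h := Real.geom_mean_le_arith_mean_weighted Finset.univ (fun _ : Fin d => 1 / (d : ℝ))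
    (schmidtNumbers ψ) (fun _ _ => by positivity) (by simp [hd'.ne']) fun k _ => hpos k
  rw [Real.finsetProd_rpow _ _ fun k _ => hpos k, ← Finset.mul_sum, hsum] at h
  calc pureGConcurrence ψ ≤ d * (1 / d * hsNormSq (coeffMatrix ψ)) := by
        unfold pureGConcurrence; gcongr
    _ = _ := by field_simp

/-- Multiplicativity of the determinant, in terms of the `G`-concurrence. -/
theorem mul_pureGConcurrence_of_mul {d : ℕ} {χ ψ φ : Fin d × Fin d → ℂ}
    (h : coeffMatrix χ = coeffMatrix ψ * coeffMatrix φ) :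
    d * pureGConcurrence χ = pureGConcurrence ψ * pureGConcurrence φ := by
  rw [pureGConcurrence_eq, pureGConcurrence_eq, pureGConcurrence_eq, h, Matrix.det_mul, norm_mul,
    mul_pow, Real.mul_rpow (by positivity) (by positivity)]
  ring

theorem pureGConcurrence_smul {d : ℕ} (hd : 0 < d) (c : ℂ) (ψ : Fin d × Fin d → ℂ) :
    pureGConcurrence (c • ψ) = ‖c‖ ^ 2 * pureGConcurrence ψ := by
  have h : coeffMatrix (c • ψ) = c • coeffMatrix ψ := by ext; simp [coeffMatrix]
  rw [pureGConcurrence_eq, pureGConcurrence_eq, h, Matrix.det_smul, norm_mul, norm_pow,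
    Fintype.card_fin, mul_pow, Real.mul_rpow (by positivity) (by positivity), ← pow_mul, mul_comm d,
    pow_mul, one_div, Real.pow_rpow_inv_natCast (by positivity) hd.ne']
  ring

/-! ### Unnormalized ensembles and the convex roof -/

/-- `ρ` is a sum of (unnormalized) pure states `|χ_i⟩⟨χ_i|` whose `G`-concurrences add up to at
most `c`. Since the pure `G`-concurrence is quadratic in the vector, this is the homogeneous form
of "the convex roof of `ρ` is at most `c`". -/
def HasEnsemble {d : ℕ} (ρ : Matrix (Fin d × Fin d) (Fin d × Fin d) ℂ) (c : ℝ) : Prop :=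
  ∃ (ι : Type) (_ : Fintype ι) (χ : ι → Fin d × Fin d → ℂ),
    ρ = ∑ i, Matrix.vecMulVec (χ i) (star (χ i)) ∧ ∑ i, pureGConcurrence (χ i) ≤ c

theorem HasEnsemble.sum {d : ℕ} {κ : Type} [Fintype κ]
    {ρ : κ → Matrix (Fin d × Fin d) (Fin d × Fin d) ℂ} {c : κ → ℝ}
    (h : ∀ k, HasEnsemble (ρ k) (c k)) : HasEnsemble (∑ k, ρ k) (∑ k, c k) := by
  choose ι hι χ hρ hc using h
  refine ⟨Σ k, ι k, inferInstance, fun x => χ x.1 x.2, ?_, ?_⟩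
  · rw [Fintype.sum_sigma]
    exact Finset.sum_congr rfl fun k _ => hρ k
  · rw [Fintype.sum_sigma]
    exact Finset.sum_le_sum fun k _ => hc k

theorem HasEnsemble.zero {d : ℕ} :
    HasEnsemble (0 : Matrix (Fin d × Fin d) (Fin d × Fin d) ℂ) 0 :=
  ⟨Empty, inferInstance, Empty.elim, by simp, by simp⟩

theorem HasEnsemble.smul {d : ℕ} (hd : 0 < d) {ρ : Matrix (Fin d × Fin d) (Fin d × Fin d) ℂ}
    {c t : ℝ} (ht : 0 ≤ t) (h : HasEnsemble ρ c) : HasEnsemble ((t : ℂ) • ρ) (t * c) := by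
  obtain ⟨ι, hι, χ, rfl, hc⟩ := h
  refine ⟨ι, hι, fun i => ((√t : ℝ) : ℂ) • χ i, ?_, ?_⟩
  · rw [Finset.smul_sum]
    refine Finset.sum_congr rfl fun i _ => ?_
    rw [star_smul, Matrix.smul_vecMulVec, Matrix.vecMulVec_smul, smul_smul]
    congr 1
    simp only [Complex.star_def, Complex.conj_ofReal]
    rw [← Complex.ofReal_mul, Real.mul_self_sqrt ht]
  · simp only [pureGConcurrence_smul hd, Complex.norm_real, Real.norm_eq_abs, sq_abs,
      Real.sq_sqrt ht]
    rw [← Finset.mul_sum]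
    gcongr

theorem HasEnsemble.nonneg {d : ℕ} {ρ : Matrix (Fin d × Fin d) (Fin d × Fin d) ℂ} {c : ℝ}
    (h : HasEnsemble ρ c) : 0 ≤ c := by
  obtain ⟨ι, hι, χ, -, hc⟩ := h
  exact (Finset.sum_nonneg fun i _ => pureGConcurrence_nonneg (χ i)).trans hc

theorem trace_vecMulVec_star {n : Type*} [Fintype n] (χ : n → ℂ) :
    (Matrix.vecMulVec χ (star χ)).trace = ((∑ x, ‖χ x‖ ^ 2 : ℝ) : ℂ) := by
  simp [Matrix.trace, Matrix.vecMulVec_apply, Complex.mul_conj']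

theorem HasEnsemble.trace_eq {d : ℕ} {ρ : Matrix (Fin d × Fin d) (Fin d × Fin d) ℂ} {c : ℝ}
    (h : HasEnsemble ρ c) : ρ.trace = (ρ.trace.re : ℂ) ∧ 0 ≤ ρ.trace.re := by
  obtain ⟨ι, hι, χ, rfl, -⟩ := h
  simp only [Matrix.trace_sum, trace_vecMulVec_star]
  rw [← Complex.ofReal_sum, Complex.ofReal_re]
  exact ⟨rfl, Finset.sum_nonneg fun i _ => by positivity⟩

theorem exists_isPureState_smul {d : ℕ} (hd : 0 < d) (χ : Fin d × Fin d → ℂ) :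
    ∃ ψ, IsPureState ψ ∧ χ = ((√(∑ x, ‖χ x‖ ^ 2) : ℝ) : ℂ) • ψ := by
  have hN : 0 ≤ ∑ x, ‖χ x‖ ^ 2 := by positivity
  rcases hN.eq_or_lt with h0 | hpos
  -- The zero vector has no direction; any pure state serves.
  · refine ⟨Pi.single (⟨0, hd⟩, ⟨0, hd⟩) 1, ?_, ?_⟩
    · rw [IsPureState, Finset.sum_eq_single (⟨0, hd⟩, ⟨0, hd⟩)]
      · simp
      · intro x _ hx; simp [Pi.single_eq_of_ne hx]
      · simp
    · rw [← h0]
      funext x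
      have := (Finset.sum_eq_zero_iff_of_nonneg (fun x _ => by positivity)).1 h0.symm x
        (Finset.mem_univ x)
      simpa using this
  · have hs : 0 < √(∑ x, ‖χ x‖ ^ 2) := Real.sqrt_pos.2 hpos
    refine ⟨((√(∑ x, ‖χ x‖ ^ 2) : ℝ) : ℂ)⁻¹ • χ, ?_, ?_⟩
    · simp only [IsPureState, Pi.smul_apply, smul_eq_mul, norm_mul, norm_inv, Complex.norm_real,
        Real.norm_eq_abs, mul_pow, inv_pow, sq_abs, Real.sq_sqrt hN]
      rw [← Finset.mul_sum, inv_mul_cancel₀ hpos.ne']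
    · rw [smul_smul, mul_inv_cancel₀ (by exact_mod_cast hs.ne'), one_smul]

/-- Normalizing the vectors of an ensemble of a trace-one matrix gives a decomposition. -/
theorem HasEnsemble.exists_isDecomposition {d : ℕ} (hd : 0 < d)
    {ρ : Matrix (Fin d × Fin d) (Fin d × Fin d) ℂ} {c : ℝ} (h : HasEnsemble ρ c)
    (htr : ρ.trace = 1) :
    ∃ (n : ℕ) (p : Fin n → ℝ) (ψ : Fin n → Fin d × Fin d → ℂ),
      IsDecomposition ρ p ψ ∧ ∑ i, p i * pureGConcurrence (ψ i) ≤ c := by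
  obtain ⟨ι, hι, χ, rfl, hc⟩ := h
  choose ψ hψ hχ using fun i => exists_isPureState_smul hd (χ i)
  have hN : ∀ i, 0 ≤ ∑ x, ‖χ i x‖ ^ 2 := fun i => by positivity
  let e := (Fintype.equivFin ι).symm
  refine ⟨Fintype.card ι, fun k => ∑ x, ‖χ (e k) x‖ ^ 2, fun k => ψ (e k),
    ⟨fun k => hN _, ?_, fun k => hψ _, ?_⟩, ?_⟩
  · rw [Equiv.sum_comp e fun i => ∑ x, ‖χ i x‖ ^ 2]
    simp only [Matrix.trace_sum, trace_vecMulVec_star] at htr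
    exact_mod_cast htr
  · rw [Equiv.sum_comp e fun i =>
      ((∑ x, ‖χ i x‖ ^ 2 : ℝ) : ℂ) • Matrix.vecMulVec (ψ i) (star (ψ i))]
    refine Finset.sum_congr rfl fun i _ => ?_
    conv_lhs => rw [hχ i]
    rw [star_smul, Matrix.smul_vecMulVec, Matrix.vecMulVec_smul, smul_smul]
    congr 1
    simp only [Complex.star_def, Complex.conj_ofReal]
    rw [← Complex.ofReal_mul, Real.mul_self_sqrt (hN i)]
  · rw [Equiv.sum_comp e fun i => (∑ x, ‖χ i x‖ ^ 2) * pureGConcurrence (ψ i)]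
    refine le_trans (Finset.sum_le_sum fun i _ => ?_) hc
    conv_rhs => rw [hχ i]
    rw [pureGConcurrence_smul hd, Complex.norm_real, Real.norm_eq_abs, sq_abs, Real.sq_sqrt (hN i)]

theorem sum_mul_pureGConcurrence_nonneg {d n : ℕ} {ρ : Matrix (Fin d × Fin d) (Fin d × Fin d) ℂ}
    {p : Fin n → ℝ} {ψ : Fin n → Fin d × Fin d → ℂ} (h : IsDecomposition ρ p ψ) :
    0 ≤ ∑ i, p i * pureGConcurrence (ψ i) :=
  Finset.sum_nonneg fun i _ => mul_nonneg (h.1 i) (pureGConcurrence_nonneg _)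

theorem gConcurrence_le {d n : ℕ} {ρ : Matrix (Fin d × Fin d) (Fin d × Fin d) ℂ}
    {p : Fin n → ℝ} {ψ : Fin n → Fin d × Fin d → ℂ} (h : IsDecomposition ρ p ψ) :
    gConcurrence ρ ≤ ∑ i, p i * pureGConcurrence (ψ i) := by
  refine csInf_le ⟨0, ?_⟩ ⟨n, p, ψ, h, rfl⟩
  rintro _ ⟨n, p, ψ, h, rfl⟩
  exact sum_mul_pureGConcurrence_nonneg h

open scoped MatrixOrder in
theorem IsDensity.exists_isDecomposition {d : ℕ} (hd : 0 < d)
    {ρ : Matrix (Fin d × Fin d) (Fin d × Fin d) ℂ} (h : IsDensity ρ) :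
    ∃ (n : ℕ) (p : Fin n → ℝ) (ψ : Fin n → Fin d × Fin d → ℂ), IsDecomposition ρ p ψ := by
  obtain ⟨B, hB⟩ := CStarAlgebra.nonneg_iff_eq_star_mul_self.mp h.1.nonneg
  have hE : HasEnsemble ρ (∑ k, pureGConcurrence fun x => Bᴴ x k) := by
    refine ⟨Fin d × Fin d, inferInstance, fun k x => Bᴴ x k, ?_, le_rfl⟩
    rw [hB, Matrix.star_eq_conjTranspose]
    ext x y
    simp [Matrix.mul_apply, Matrix.sum_apply, Matrix.vecMulVec_apply]
  obtain ⟨n, p, ψ, hdec, -⟩ := hE.exists_isDecomposition hd h.2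
  exact ⟨n, p, ψ, hdec⟩

/-- A lower bound for all decompositions, up to a nonnegative factor, passes to the convex roof. -/
theorem le_gConcurrence_mul {d : ℕ} (hd : 0 < d) {ρ : Matrix (Fin d × Fin d) (Fin d × Fin d) ℂ}
    (hρ : IsDensity ρ) {x b : ℝ} (hb : 0 ≤ b)
    (h : ∀ (n : ℕ) (p : Fin n → ℝ) (ψ : Fin n → Fin d × Fin d → ℂ), IsDecomposition ρ p ψ →
      x ≤ (∑ i, p i * pureGConcurrence (ψ i)) * b) :
    x ≤ gConcurrence ρ * b := by
  obtain ⟨n, p, ψ, hdec⟩ := hρ.exists_isDecomposition hd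
  rcases hb.eq_or_lt with rfl | hb
  · simpa using h n p ψ hdec
  · rw [← div_le_iff₀ hb]
    refine le_csInf ⟨_, n, p, ψ, hdec, rfl⟩ ?_
    rintro _ ⟨n, p, ψ, h', rfl⟩
    rw [div_le_iff₀ hb]
    exact h n p ψ h'

theorem gConcurrence_nonneg {d : ℕ} (ρ : Matrix (Fin d × Fin d) (Fin d × Fin d) ℂ) :
    0 ≤ gConcurrence ρ := by
  refine Real.sInf_nonneg ?_
  rintro _ ⟨n, p, ψ, h, rfl⟩
  exact sum_mul_pureGConcurrence_nonneg h

/-- Passing from an unnormalized state to its trace times the concurrence of the normalized state, as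
in `Q_j G(σ_j)`. -/
theorem HasEnsemble.trace_mul_gConcurrence_le {d : ℕ} (hd : 0 < d)
    {ρ : Matrix (Fin d × Fin d) (Fin d × Fin d) ℂ} {c : ℝ} (h : HasEnsemble ρ c) :
    ρ.trace.re * gConcurrence ((ρ.trace.re : ℂ)⁻¹ • ρ) ≤ c := by
  obtain ⟨htr, hq⟩ := h.trace_eq
  rcases hq.eq_or_lt with h0 | hq
  -- At trace `0` the normalized state is a junk value, but its weight vanishes.
  · rw [← h0, zero_mul]; exact h.nonneg
  have hE := h.smul hd (inv_nonneg.2 hq.le)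
  rw [Complex.ofReal_inv] at hE
  obtain ⟨n, p, ψ, hdec, hle⟩ := hE.exists_isDecomposition hd (by
    rw [Matrix.trace_smul, smul_eq_mul]
    conv_lhs => rw [htr]
    rw [Complex.ofReal_re]
    exact inv_mul_cancel₀ (by exact_mod_cast hq.ne'))
  have := (gConcurrence_le hdec).trans hle
  calc _ ≤ ρ.trace.re * (ρ.trace.re⁻¹ * c) := by gcongr
    _ = c := by field_simp

/-! ### Local operators on a product of pure states -/

theorem conjugate_conjugate {l m n : Type*} [Fintype m] [Fintype n] (K : Matrix l m ℂ)
    (L : Matrix m n ℂ) (ρ : Matrix n n ℂ) :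
    conjugate K (conjugate L ρ) = conjugate (K * L) ρ := by
  simp only [conjugate, Matrix.conjTranspose_mul, Matrix.mul_assoc]

theorem conjugate_vecMulVec {m n : Type*} [Fintype n] (K : Matrix m n ℂ) (w : n → ℂ) :
    conjugate K (Matrix.vecMulVec w (star w)) = Matrix.vecMulVec (K *ᵥ w) (star (K *ᵥ w)) := by
  rw [conjugate, Matrix.mul_vecMulVec, Matrix.vecMulVec_mul, Matrix.star_mulVec]

/-- `|ψ⟩ ⊗ |φ⟩` as a vector of the joint system, with Sapna holding the two middle shares. -/
def jointVec {d : ℕ} (ψ φ : Fin d × Fin d → ℂ) : Fin d × Fin (d * d) × Fin d → ℂ :=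
  fun x => ψ (x.1, (finProdFinEquiv.symm x.2.1).1) * φ ((finProdFinEquiv.symm x.2.1).2, x.2.2)

theorem initialState_vecMulVec {d : ℕ} (ψ φ : Fin d × Fin d → ℂ) :
    initialState (Matrix.vecMulVec ψ (star ψ)) (Matrix.vecMulVec φ (star φ)) =
      Matrix.vecMulVec (jointVec ψ φ) (star (jointVec ψ φ)) := by
  ext x y
  simp [initialState, jointVec, Matrix.vecMulVec_apply, Matrix.kroneckerMap_apply]
  ring

theorem traceSapna_vecMulVec {a s b : ℕ} (w : Fin a × Fin s × Fin b → ℂ) :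
    traceSapna (Matrix.vecMulVec w (star w)) =
      ∑ k, Matrix.vecMulVec (fun x : Fin a × Fin b => w (x.1, k, x.2))
        (star fun x : Fin a × Fin b => w (x.1, k, x.2)) := by
  ext x y
  simp [traceSapna, Matrix.sum_apply, Matrix.vecMulVec_apply]

/-- The vector whose coefficient matrix is `M`. -/
def ofCoeff {d : ℕ} (M : Matrix (Fin d) (Fin d) ℂ) : Fin d × Fin d → ℂ := fun x => M x.1 x.2

@[simp]
theorem coeffMatrix_ofCoeff {d : ℕ} (M : Matrix (Fin d) (Fin d) ℂ) :
    coeffMatrix (ofCoeff M) = M := rfl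

/-- The `k`-th row of an operator on Sapna's pair of shares, arranged as a `d × d` matrix. -/
def rowMatrix {d s : ℕ} (S : Matrix (Fin s) (Fin (d * d)) ℂ) (k : Fin s) :
    Matrix (Fin d) (Fin d) ℂ :=
  Matrix.of fun u v => S k (finProdFinEquiv (u, v))

theorem sum_hsNormSq_rowMatrix {d s : ℕ} (S : Matrix (Fin s) (Fin (d * d)) ℂ) :
    ∑ k, hsNormSq (rowMatrix S k) = hsNormSq S := by
  refine Finset.sum_congr rfl fun k _ => ?_
  rw [← Equiv.sum_comp finProdFinEquiv, Fintype.sum_prod_type]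
  rfl

theorem hsNormSq_transpose {m n : Type*} [Fintype m] [Fintype n] (M : Matrix m n ℂ) :
    hsNormSq Mᵀ = hsNormSq M :=
  Finset.sum_comm

/-- If Sapna's output is found in the basis state `k`, the coefficient matrix of the vector left to
Alice and Bob is a product in which the initial coefficient matrices appear as factors. -/
theorem mulVec_jointVec {d s : ℕ} (M N : Matrix (Fin d) (Fin d) ℂ)
    (S : Matrix (Fin s) (Fin (d * d)) ℂ) (ψ φ : Fin d × Fin d → ℂ) (k : Fin s) :
    (fun x : Fin d × Fin d => ((M ⊗ₖ (S ⊗ₖ N)) *ᵥ jointVec ψ φ) (x.1, k, x.2)) =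
      ofCoeff (M * (coeffMatrix ψ * (rowMatrix S k * (coeffMatrix φ * Nᵀ)))) := by
  funext x
  simp only [Matrix.mulVec, dotProduct, Matrix.kroneckerMap_apply, jointVec, ofCoeff,
    Matrix.mul_apply, coeffMatrix, rowMatrix, Matrix.of_apply, Matrix.transpose_apply,
    Fintype.sum_prod_type, Finset.mul_sum]
  refine Finset.sum_congr rfl fun i _ => ?_
  rw [← Equiv.sum_comp finProdFinEquiv, Fintype.sum_prod_type]
  refine Finset.sum_congr rfl fun u _ => Finset.sum_congr rfl fun v _ =>
    Finset.sum_congr rfl fun j _ => ?_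
  simp only [Equiv.symm_apply_apply]
  ring

theorem pureGConcurrence_ofCoeff_le {d : ℕ} (M C N : Matrix (Fin d) (Fin d) ℂ)
    (ψ φ : Fin d × Fin d → ℂ) :
    (d : ℝ) ^ 4 * pureGConcurrence (ofCoeff (M * (coeffMatrix ψ * (C * (coeffMatrix φ * N))))) ≤
      hsNormSq M * hsNormSq C * hsNormSq N * (pureGConcurrence ψ * pureGConcurrence φ) := by
  have hmul : ∀ X Y : Matrix (Fin d) (Fin d) ℂ, d * pureGConcurrence (ofCoeff (X * Y)) =
      pureGConcurrence (ofCoeff X) * pureGConcurrence (ofCoeff Y) :=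
    fun X Y => mul_pureGConcurrence_of_mul rfl
  have hM := pureGConcurrence_le (ofCoeff M)
  have hC := pureGConcurrence_le (ofCoeff C)
  have hN := pureGConcurrence_le (ofCoeff N)
  have hC0 := pureGConcurrence_nonneg (ofCoeff C)
  have hN0 := pureGConcurrence_nonneg (ofCoeff N)
  have hψ := pureGConcurrence_nonneg ψ
  have hφ := pureGConcurrence_nonneg φ
  have hM1 := hsNormSq_nonneg M
  have hC1 := hsNormSq_nonneg C
  simp only [coeffMatrix_ofCoeff] at hM hC hN
  calc (d : ℝ) ^ 4 * pureGConcurrence (ofCoeff (M * (coeffMatrix ψ * (C * (coeffMatrix φ * N)))))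
      = d ^ 3 * (d * pureGConcurrence
          (ofCoeff (M * (coeffMatrix ψ * (C * (coeffMatrix φ * N)))))) := by ring
    _ = pureGConcurrence (ofCoeff M) * (d ^ 2 * (d * pureGConcurrence
          (ofCoeff (coeffMatrix ψ * (C * (coeffMatrix φ * N)))))) := by rw [hmul]; ring
    _ = pureGConcurrence (ofCoeff M) * pureGConcurrence ψ * (d * (d * pureGConcurrence
          (ofCoeff (C * (coeffMatrix φ * N))))) := by
        rw [hmul (coeffMatrix ψ)]; change _ * (_ * (pureGConcurrence ψ * _)) = _; ring
    _ = pureGConcurrence (ofCoeff M) * pureGConcurrence ψ * pureGConcurrence (ofCoeff C) *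
          (d * pureGConcurrence (ofCoeff (coeffMatrix φ * N))) := by rw [hmul C]; ring
    _ = pureGConcurrence (ofCoeff M) * pureGConcurrence (ofCoeff C) * pureGConcurrence (ofCoeff N) *
          (pureGConcurrence ψ * pureGConcurrence φ) := by
        rw [hmul (coeffMatrix φ)]; change _ * (pureGConcurrence φ * _) = _; ring
    _ ≤ _ := by gcongr

/-! ### Protocols -/

/-- Run a protocol `P` after the parties have already applied the local operators `M`, `S`, `N` to a
product of pure states. Carrying these operators along makes the bound inductive: at each
measurement it is conserved by the completeness relation, and it has to be verified only at the
leaves, where the local dimensions of Alice and Bob are `d`. -/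
theorem LOCC.exists_hasEnsemble_run {d r : ℕ} (ψ φ : Fin d × Fin d → ℂ)
    {a s b : ℕ} (P : LOCC d r a s b) :
    ∀ (M : Matrix (Fin a) (Fin d) ℂ) (S : Matrix (Fin s) (Fin (d * d)) ℂ)
      (N : Matrix (Fin b) (Fin d) ℂ), ∃ c : Fin r → ℝ,
      (∀ j, HasEnsemble (P.run (conjugate (M ⊗ₖ (S ⊗ₖ N))
        (Matrix.vecMulVec (jointVec ψ φ) (star (jointVec ψ φ)))) j) (c j)) ∧
      (d : ℝ) ^ 4 * ∑ j, c j ≤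
        hsNormSq M * hsNormSq S * hsNormSq N * (pureGConcurrence ψ * pureGConcurrence φ) := by
  induction P with
  | @halt s label =>
    intro M S N
    refine ⟨fun j => if label = j then ∑ k, pureGConcurrence
      (ofCoeff (M * (coeffMatrix ψ * (rowMatrix S k * (coeffMatrix φ * Nᵀ))))) else 0,
      fun j => ?_, ?_⟩
    · simp only [LOCC.run]
      split_ifs
      · rw [conjugate_vecMulVec, traceSapna_vecMulVec]
        simp only [mulVec_jointVec]
        exact ⟨Fin s, inferInstance, _, rfl, le_rfl⟩
      · exact HasEnsemble.zero
    · rw [Finset.sum_ite_eq, if_pos (Finset.mem_univ _), ← sum_hsNormSq_rowMatrix S,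
        ← hsNormSq_transpose N, Finset.mul_sum, Finset.mul_sum, Finset.sum_mul, Finset.sum_mul]
      exact Finset.sum_le_sum fun k _ => pureGConcurrence_ofCoeff_le _ _ _ _ _
  | alice K hK next ih =>
    intro M S N
    choose c hc hle using fun i => ih i (K i * M) S N
    refine ⟨fun j => ∑ i, c i j, fun j => ?_, ?_⟩
    · simp only [LOCC.run, conjugate_conjugate, ← Matrix.mul_kronecker_mul, Matrix.one_mul]
      exact HasEnsemble.sum fun i => hc i j
    · rw [Finset.sum_comm, Finset.mul_sum, ← sum_hsNormSq_mul K hK M]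
      simp only [Finset.sum_mul]
      exact Finset.sum_le_sum fun i _ => hle i
  | sapna K hK next ih =>
    intro M S N
    choose c hc hle using fun i => ih i M (K i * S) N
    refine ⟨fun j => ∑ i, c i j, fun j => ?_, ?_⟩
    · simp only [LOCC.run, conjugate_conjugate, ← Matrix.mul_kronecker_mul, Matrix.one_mul]
      exact HasEnsemble.sum fun i => hc i j
    · rw [Finset.sum_comm, Finset.mul_sum, ← sum_hsNormSq_mul K hK S]
      refine (Finset.sum_le_sum fun i _ => hle i).trans_eq ?_
      simp only [Finset.mul_sum, Finset.sum_mul]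
  | bob K hK next ih =>
    intro M S N
    choose c hc hle using fun i => ih i M S (K i * N)
    refine ⟨fun j => ∑ i, c i j, fun j => ?_, ?_⟩
    · simp only [LOCC.run, conjugate_conjugate, ← Matrix.mul_kronecker_mul, Matrix.one_mul]
      exact HasEnsemble.sum fun i => hc i j
    · rw [Finset.sum_comm, Finset.mul_sum, ← sum_hsNormSq_mul K hK N, Finset.mul_sum,
        Finset.sum_mul]
      exact Finset.sum_le_sum fun i _ => hle i

theorem LOCC.exists_hasEnsemble_run_initialState {d r : ℕ} (hd : 0 < d)
    (ψ φ : Fin d × Fin d → ℂ) (P : LOCC d r d (d * d) d) :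
    ∃ c : Fin r → ℝ,
      (∀ j, HasEnsemble (P.run (initialState (Matrix.vecMulVec ψ (star ψ))
        (Matrix.vecMulVec φ (star φ))) j) (c j)) ∧
      ∑ j, c j ≤ pureGConcurrence ψ * pureGConcurrence φ := by
  obtain ⟨c, hc, hle⟩ := LOCC.exists_hasEnsemble_run ψ φ P 1 1 1
  refine ⟨c, ?_, ?_⟩
  · simpa [initialState_vecMulVec, conjugate] using hc
  · simp only [hsNormSq_one, Fintype.card_fin, Nat.cast_mul] at hle
    have hd' : (0 : ℝ) < d ^ 4 := by positivity
    refine le_of_mul_le_mul_left (hle.trans_eq ?_) hd'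
    ring

/-! ### Mixed initial states -/

theorem conjugate_add {m n : Type*} [Fintype n] (K : Matrix m n ℂ) (ρ σ : Matrix n n ℂ) :
    conjugate K (ρ + σ) = conjugate K ρ + conjugate K σ := by
  simp [conjugate, Matrix.mul_add, Matrix.add_mul]

theorem conjugate_smul {m n : Type*} [Fintype n] (K : Matrix m n ℂ) (t : ℂ) (ρ : Matrix n n ℂ) :
    conjugate K (t • ρ) = t • conjugate K ρ := by
  simp [conjugate]

theorem LOCC.run_add {d r a s b : ℕ} (P : LOCC d r a s b) (j : Fin r) :
    ∀ ρ σ : Joint a s b, P.run (ρ + σ) j = P.run ρ j + P.run σ j := by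
  induction P with
  | halt label =>
    intro ρ σ
    simp only [LOCC.run]
    split_ifs
    · ext; simp [traceSapna, Finset.sum_add_distrib]
    · simp
  | alice K hK next ih | sapna K hK next ih | bob K hK next ih =>
    intro ρ σ
    simp only [LOCC.run, conjugate_add, ih, Finset.sum_add_distrib]

theorem LOCC.run_smul {d r a s b : ℕ} (P : LOCC d r a s b) (j : Fin r) :
    ∀ (t : ℂ) (ρ : Joint a s b), P.run (t • ρ) j = t • P.run ρ j := by
  induction P with
  | halt label =>
    intro t ρ
    simp only [LOCC.run]
    split_ifs
    · ext; simp [traceSapna, Finset.mul_sum]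
    · simp
  | alice K hK next ih | sapna K hK next ih | bob K hK next ih =>
    intro t ρ
    simp only [LOCC.run, conjugate_smul, ih, Finset.smul_sum]

/-- Running a protocol is linear in the initial state. -/
def LOCC.runLinear {d r a s b : ℕ} (P : LOCC d r a s b) (j : Fin r) :
    Joint a s b →ₗ[ℂ] Matrix (Fin d × Fin d) (Fin d × Fin d) ℂ where
  toFun ρ := P.run ρ j
  map_add' := P.run_add j
  map_smul' := P.run_smul j

theorem LOCC.run_sum_smul {d r a s b : ℕ} {ι : Type*} [Fintype ι] (P : LOCC d r a s b) (j : Fin r)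
    (t : ι → ℂ) (ρ : ι → Joint a s b) :
    P.run (∑ i, t i • ρ i) j = ∑ i, t i • P.run (ρ i) j := by
  exact (map_sum (P.runLinear j) (fun i => t i • ρ i) Finset.univ).trans
    (Finset.sum_congr rfl fun i _ => P.run_smul j (t i) (ρ i))

theorem initialState_sum {d n m : ℕ} (p : Fin n → ℝ) (q : Fin m → ℝ)
    (ρ : Fin n → Matrix (Fin d × Fin d) (Fin d × Fin d) ℂ)
    (σ : Fin m → Matrix (Fin d × Fin d) (Fin d × Fin d) ℂ) :
    initialState (∑ i, (p i : ℂ) • ρ i) (∑ k, (q k : ℂ) • σ k) =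
      ∑ x : Fin n × Fin m, ((p x.1 * q x.2 : ℝ) : ℂ) • initialState (ρ x.1) (σ x.2) := by
  ext x y
  simp only [initialState, Matrix.submatrix_apply, Matrix.kroneckerMap_apply, Matrix.sum_apply,
    Matrix.smul_apply, smul_eq_mul, Finset.sum_mul_sum, Fintype.sum_prod_type, Complex.ofReal_mul]
  refine Finset.sum_congr rfl fun i _ => Finset.sum_congr rfl fun k _ => ?_
  ring

theorem LOCC.sum_prob_mul_gConcurrence_le {d r n m : ℕ} (hd : 0 < d)
    {ρ₁₂ ρ₃₄ : Matrix (Fin d × Fin d) (Fin d × Fin d) ℂ} (P : LOCC d r d (d * d) d)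
    {p : Fin n → ℝ} {ψ : Fin n → Fin d × Fin d → ℂ} (hp : IsDecomposition ρ₁₂ p ψ)
    {q : Fin m → ℝ} {φ : Fin m → Fin d × Fin d → ℂ} (hq : IsDecomposition ρ₃₄ q φ) :
    ∑ j, P.prob (initialState ρ₁₂ ρ₃₄) j * gConcurrence (P.finalState (initialState ρ₁₂ ρ₃₄) j) ≤
      (∑ i, p i * pureGConcurrence (ψ i)) * ∑ k, q k * pureGConcurrence (φ k) := by
  choose c hc hle using fun x : Fin n × Fin m =>
    LOCC.exists_hasEnsemble_run_initialState hd (ψ x.1) (φ x.2) P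
  have hpq : ∀ x : Fin n × Fin m, 0 ≤ p x.1 * q x.2 := fun x => mul_nonneg (hp.1 _) (hq.1 _)
  have hE : ∀ j, HasEnsemble (P.run (initialState ρ₁₂ ρ₃₄) j) (∑ x, p x.1 * q x.2 * c x j) := by
    intro j
    rw [hp.2.2.2, hq.2.2.2, initialState_sum, LOCC.run_sum_smul]
    exact HasEnsemble.sum fun x => (hc x j).smul hd (hpq x)
  calc _ ≤ ∑ j, ∑ x, p x.1 * q x.2 * c x j :=
        Finset.sum_le_sum fun j _ => (hE j).trace_mul_gConcurrence_le hd
    _ = ∑ x : Fin n × Fin m, p x.1 * q x.2 * ∑ j, c x j := by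
        rw [Finset.sum_comm]; simp only [Finset.mul_sum]
    _ ≤ ∑ x : Fin n × Fin m, p x.1 * q x.2 *
          (pureGConcurrence (ψ x.1) * pureGConcurrence (φ x.2)) :=
        Finset.sum_le_sum fun x _ => mul_le_mul_of_nonneg_left (hle x) (hpq x)
    _ = _ := by
        rw [Finset.sum_mul_sum, Fintype.sum_prod_type]
        refine Finset.sum_congr rfl fun i _ => Finset.sum_congr rfl fun k _ => ?_
        ring

end QNet

open QNet in
theorem theorem1 {d r : ℕ} (ρ₁₂ ρ₃₄ : Matrix (Fin d × Fin d) (Fin d × Fin d) ℂ)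
    (h₁₂ : QNet.IsDensity ρ₁₂) (h₃₄ : QNet.IsDensity ρ₃₄)
    (P : QNet.LOCC d r d (d * d) d) :
    ∑ j, P.prob (QNet.initialState ρ₁₂ ρ₃₄) j *
        QNet.gConcurrence (P.finalState (QNet.initialState ρ₁₂ ρ₃₄) j) ≤
      QNet.gConcurrence ρ₁₂ * QNet.gConcurrence ρ₃₄ := by
  -- In dimension `0` there is no matrix of trace one.
  have hd : 0 < d := by
    rcases Nat.eq_zero_or_pos d with rfl | hd
    · simpa [Matrix.trace] using h₁₂.2
    · exact hd
  refine le_gConcurrence_mul hd h₁₂ (gConcurrence_nonneg _) fun n p ψ hp => ?_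
  refine (le_gConcurrence_mul hd h₃₄ (sum_mul_pureGConcurrence_nonneg hp) fun m q φ hq => ?_).trans_eq
    (mul_comm _ _)
  exact (P.sum_prob_mul_gConcurrence_le hd hp hq).trans_eq (mul_comm _ _)
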